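/- Let $m\in\{2,3,\dots\}\cup\{\infty\}$, let $n$ be an integer with $1\le n<m$, let $\mathbb F_m$ be the free group with free generators $g_1,g_2,\dots$ ($m$ of them), and regard $\mathbb F_n$ as the subgroup of $\mathbb F_m$ generated by $g_1,\dots,g_n$. Let $\mathcal M=VN(\mathbb F_m)$ be the group von Neumann algebra, i.e. the von Neumann algebra on $\ell^2(\mathbb F_m)$ generated by the left translations $\lambda(g)$, $g\in\mathbb F_m$, with normalized trace $\mathrm{tr}(x)=\langle x\delta_e,\delta_e\rangle$ and $\|x\|_2=\mathrm{tr}(x^*x)^{1/2}$, and let $\mathcal N=VN(\mathbb F_n)\subseteq\mathcal M$ be the von Neumann subalgebra generated by $\lambda(g)$, $g\in\mathbb F_n$. For a linear map $\phi:\mathcal M\to\mathcal M$ put $\|\phi\|_{\infty,2}=\sup\{\|\phi(x)\|_2 : x\in\mathcal M,\ \|x\|\le 1\}$, where $\|\cdot\|$ is the operator norm. Then, for every unitary $u\in\mathcal M$, there are unique trace preserving conditional expectations $\mathbb E_{\mathcal N}$ and $\mathbb E_{u\mathcal Nu^*}$ of $\mathcal M$ onto $\mathcal N$ and onto $u\mathcal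 Nu^*=\{uyu^*: y\in\mathcal N\}$, the quantity $\|\mathbb E_{u\mathcal Nu^*}-\mathbb E_{\mathcal N}\|_{\infty,2}$ is finite, and $$\|u-\mathbb E_{\mathcal N}(u)\|_2\le\|\mathbb E_{u\mathcal Nu^*}-\mathbb E_{\mathcal N}\|_{\infty,2}.$$ -/

import Mathlib

/-! ### Von Neumann algebras generated by a set, and unitary conjugates -/

section General

universe u

variable {H : Type u} [NormedAddCommGroup H] [InnerProductSpace ℂ H] [CompleteSpace H]

/-- The von Neumann algebra generated by a set `S` of bounded operators: the double commutant of
`S ∪ S*` (`StarSubalgebra.centralizer ℂ S` is the commutant of `S ∪ S*`). -/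
noncomputable def VonNeumannAlgebra.generatedBy (S : Set (H →L[ℂ] H)) : VonNeumannAlgebra H where
  toStarSubalgebra :=
    StarSubalgebra.centralizer ℂ (StarSubalgebra.centralizer ℂ S : Set (H →L[ℂ] H))
  centralizer_centralizer' := by
    change Set.centralizer (Set.centralizer
      ((StarSubalgebra.centralizer ℂ (StarSubalgebra.centralizer ℂ S : Set (H →L[ℂ] H)) :
        StarSubalgebra ℂ (H →L[ℂ] H)) : Set (H →L[ℂ] H))) =
      ((StarSubalgebra.centralizer ℂ (StarSubalgebra.centralizer ℂ S : Set (H →L[ℂ] H)) :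
        StarSubalgebra ℂ (H →L[ℂ] H)) : Set (H →L[ℂ] H))
    rw [StarSubalgebra.coe_centralizer_centralizer, Set.centralizer_centralizer_centralizer]

theorem VonNeumannAlgebra.centralizer_image_conj (u : unitary (H →L[ℂ] H))
    (S : Set (H →L[ℂ] H)) :
    Set.centralizer (Unitary.conjStarAlgAut ℂ (H →L[ℂ] H) u '' S) =
      Unitary.conjStarAlgAut ℂ (H →L[ℂ] H) u '' Set.centralizer S := by
  set φ := Unitary.conjStarAlgAut ℂ (H →L[ℂ] H) u
  ext z
  constructor
  · intro hz
    refine ⟨φ.symm z, ?_, φ.apply_symm_apply z⟩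
    intro y hy
    apply φ.injective
    have h := hz _ ⟨y, hy, rfl⟩
    rw [← φ.apply_symm_apply z, ← map_mul, ← map_mul] at h
    exact h
  · rintro ⟨w, hw, rfl⟩ _ ⟨y, hy, rfl⟩
    rw [← map_mul, ← map_mul, hw y hy]

/-- The von Neumann algebra `u N u* = {u y u* : y ∈ N}`. -/
noncomputable def VonNeumannAlgebra.conj (u : unitary (H →L[ℂ] H)) (N : VonNeumannAlgebra H) :
    VonNeumannAlgebra H where
  toStarSubalgebra :=
    N.toStarSubalgebra.map 
      (Unitary.conjStarAlgAut ℂ (H →L[ℂ] H) u).toStarAlgHom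
  centralizer_centralizer' := by
    change Set.centralizer (Set.centralizer
      (Unitary.conjStarAlgAut ℂ (H →L[ℂ] H) u '' (N : Set (H →L[ℂ] H)))) =
      Unitary.conjStarAlgAut ℂ (H →L[ℂ] H) u '' (N : Set (H →L[ℂ] H))
    rw [VonNeumannAlgebra.centralizer_image_conj, VonNeumannAlgebra.centralizer_image_conj,
      VonNeumannAlgebra.centralizer_centralizer]

end General

/-! ### Group von Neumann algebras -/

namespace GroupVN

universe u

/-- The Hilbert space `ℓ²(Γ)`. -/
abbrev L2 (Γ : Type u) : Type u := lp (fun _ : Γ => ℂ) 2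

section Group

variable {Γ : Type u} [Group Γ]

theorem memℓp_translate (g : Γ) (f : L2 Γ) :
    Memℓp (fun h : Γ => (f : Γ → ℂ) (g⁻¹ * h)) 2 := by
  have h2 : 0 < (2 : ENNReal).toReal := by norm_num
  refine memℓp_gen ?_
  exact (Equiv.mulLeft g⁻¹).summable_iff.mpr ((lp.memℓp f).summable h2)

/-- The left regular representation: `(leftRegular g f) h = f (g⁻¹ h)`, a linear isometry of
`ℓ²(Γ)`. -/
noncomputable def leftRegularIsometry (g : Γ) : L2 Γ →ₗᵢ[ℂ] L2 Γ where
  toFun f := ⟨fun h => (f : Γ → ℂ) (g⁻¹ * h), memℓp_translate g f⟩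
  map_add' f₁ f₂ := by ext h; rfl
  map_smul' c f := by ext h; rfl
  norm_map' f := by
    have h2 : 0 < (2 : ENNReal).toReal := by norm_num
    rw [lp.norm_eq_tsum_rpow h2, lp.norm_eq_tsum_rpow h2]
    congr 1
    exact (Equiv.mulLeft g⁻¹).tsum_eq (fun h => ‖(f : Γ → ℂ) h‖ ^ (2 : ENNReal).toReal)

/-- The left regular representation, as bounded operators on `ℓ²(Γ)`. -/
noncomputable def leftRegular (g : Γ) : L2 Γ →L[ℂ] L2 Γ :=
  (leftRegularIsometry g).toContinuousLinearMap

/-- For a subgroup `G` of `Γ`, the von Neumann algebra `VN(G)`, regarded as a subalgebra of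
`VN(Γ)`: the von Neumann algebra on `ℓ²(Γ)` generated by the left translations by elements
of `G`. In particular `VN ⊤` is the group von Neumann algebra `VN(Γ)`. -/
noncomputable def VN (G : Subgroup Γ) : VonNeumannAlgebra (L2 Γ) :=
  VonNeumannAlgebra.generatedBy (leftRegular '' (G : Set Γ))

open scoped Classical in
/-- The unit vector `δ_e` of `ℓ²(Γ)`. -/
noncomputable def deltaOne (Γ : Type u) [Group Γ] : L2 Γ := lp.single 2 (1 : Γ) (1 : ℂ)

/-- The elements of the group von Neumann algebra `VN(Γ)`, as a complex star algebra. -/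
noncomputable abbrev M (Γ : Type u) [Group Γ] : StarSubalgebra ℂ (L2 Γ →L[ℂ] L2 Γ) :=
  (VN (⊤ : Subgroup Γ)).toStarSubalgebra

/-- The normalized trace `tr x = ⟨x δ_e, δ_e⟩` of `VN(Γ)` (Mathlib's inner product is linear in
the second variable). -/
noncomputable def tr (x : M Γ) : ℂ :=
  inner ℂ (deltaOne Γ) ((x : L2 Γ →L[ℂ] L2 Γ) (deltaOne Γ))

/-- The norm `‖x‖₂ = tr(x* x)^{1/2}`. -/
noncomputable def normTwo (x : M Γ) : ℝ := Real.sqrt (tr (star x * x)).re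

theorem unitary_coe_mem (u : unitary (M Γ)) :
    ((u : M Γ) : L2 Γ →L[ℂ] L2 Γ) ∈ unitary (L2 Γ →L[ℂ] L2 Γ) :=
  Unitary.mem_iff.mpr
    ⟨congrArg (Subtype.val : M Γ → L2 Γ →L[ℂ] L2 Γ) (Unitary.coe_star_mul_self u),
      congrArg (Subtype.val : M Γ → L2 Γ →L[ℂ] L2 Γ) (Unitary.coe_mul_star_self u)⟩

/-- The von Neumann subalgebra `u N u*`, for a unitary `u` of `VN(Γ)`. -/
noncomputable def conj (u : unitary (M Γ)) (N : VonNeumannAlgebra (L2 Γ)) :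
    VonNeumannAlgebra (L2 Γ) :=
  VonNeumannAlgebra.conj (⟨((u : M Γ) : L2 Γ →L[ℂ] L2 Γ), unitary_coe_mem u⟩) N

/-- `E : VN(Γ) → VN(Γ)` is a trace preserving conditional expectation onto the von Neumann
subalgebra `N`. -/
structure IsCondExp (N : VonNeumannAlgebra (L2 Γ)) (E : M Γ →ₗ[ℂ] M Γ) : Prop where
  /-- the range lies in `N` -/
  mem : ∀ x, (E x : L2 Γ →L[ℂ] L2 Γ) ∈ N
  /-- `E` is the identity on `N` -/
  fix : ∀ x : M Γ, (x : L2 Γ →L[ℂ] L2 Γ) ∈ N → E x = x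
  /-- `E` is positive -/
  pos : ∀ x : M Γ, (x : L2 Γ →L[ℂ] L2 Γ).IsPositive → (E x : L2 Γ →L[ℂ] L2 Γ).IsPositive
  /-- `E` is an `N`-bimodule map -/
  bimodule : ∀ a b x : M Γ, (a : L2 Γ →L[ℂ] L2 Γ) ∈ N → (b : L2 Γ →L[ℂ] L2 Γ) ∈ N →
    E (a * x * b) = a * E x * b
  /-- `E` preserves the trace -/
  tr_eq : ∀ x : M Γ, tr (E x) = tr x

open scoped Classical in
/-- The trace preserving conditional expectation of `VN(Γ)` onto `N` (zero if there is none). -/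
noncomputable def condExp (N : VonNeumannAlgebra (L2 Γ)) : M Γ →ₗ[ℂ] M Γ :=
  if h : ∃ E, IsCondExp N E then h.choose else 0

/-- The values `‖φ(x)‖₂`, for `x` in the operator norm unit ball of `VN(Γ)`. -/
def unitBallValues (φ : M Γ →ₗ[ℂ] M Γ) : Set ℝ :=
  {r | ∃ x : M Γ, ‖(x : L2 Γ →L[ℂ] L2 Γ)‖ ≤ 1 ∧ r = normTwo (φ x)}

/-- The norm `‖φ‖_{∞,2}` of a linear map `φ` that is bounded from the operator norm to `‖·‖₂`. -/
noncomputable def normInfTwo (φ : M Γ →ₗ[ℂ] M Γ) : ℝ := sSup (unitBallValues φ)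

end Group

/-! ### Free groups -/

/-- The free group `F_m` on `m` generators, `m ∈ {0, 1, 2, …, ∞}`; the generators are numbered
`0, 1, 2, …`. -/
abbrev Free (m : ℕ∞) : Type := FreeGroup {i : ℕ // (i : ℕ∞) < m}

/-- The subgroup of `F_m` generated by the first `n` generators. -/
def firstGenerators (n m : ℕ∞) : Subgroup (Free m) :=
  Subgroup.closure (FreeGroup.of '' {i : {i : ℕ // (i : ℕ∞) < m} | ((i : ℕ) : ℕ∞) < n})

end GroupVN

namespace GroupVN

universe u v

/-! ### Coordinates and restrictions in `ℓ²` -/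

section Coordinates

variable {Γ : Type u}

/-! Let `v = λ(g)` with `g` in the subgroup `G = F_n`. Since `v` lies in `N`, it is fixed by `E_N`,
and Pythagoras for `E_{uNu*} = u E_N(u* · u) u*` gives `‖(E_{uNu*} - E_N)(v)‖₂² = 1 - ‖E_N(u* v
u)‖₂²` (`one_sub_norm_sq_le_normInfTwo_sq`). Split `u = E_N(u) + u'`. The first summand contributes
at most `‖E_N(u)‖₂` to `‖E_N(u* v u)‖₂`; the second contributes `‖E_N(u* v u')‖₂`, which tends to
`0` along `g = g₁^k`. In the limit, `1 - ‖E_N(u)‖₂² = ‖u - E_N(u)‖₂²` is at most the square of the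
norm of the difference.

The decay rests on a form of malnormality: for `h ∉ G` and any `x`, at most one `k` has `x g₁^k h ∈
G`, because two of them would put a conjugate `h⁻¹ g₁^j h`, `j > 0`, in `G`, which forces `h ∈ G`
(`FreeGroup.mem_closure_of_conj_pow_mem`).

All of this is computed on vectors: `x` is determined by `x δ_e`, membership in `VN(G)` is a support
condition on it (`mem_VN_iff`), and `E_N` truncates it to `G`. Boundedness and positivity of `E_N`
come from realizing it as a block diagonal part. -/

theorem hasSum_norm_sq (f : L2 Γ) : HasSum (fun k => ‖f k‖ ^ 2) (‖f‖ ^ 2) := by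
  have h := lp.hasSum_norm (by norm_num : 0 < (2 : ENNReal).toReal) f
  simpa using h

theorem memℓp_of_summable_sq {f : Γ → ℂ} (hf : Summable fun k => ‖f k‖ ^ 2) :
    Memℓp (E := fun _ : Γ => ℂ) f 2 :=
  memℓp_gen (by simpa using hf)

open scoped Classical in
/-- The unit vector `δ_g` of `ℓ²(Γ)`. -/
noncomputable def delta (g : Γ) : L2 Γ := lp.single 2 g (1 : ℂ)

open scoped Classical in
theorem delta_apply (g k : Γ) : delta g k = if k = g then 1 else 0 := by
  simp [delta, Pi.single_apply]

theorem delta_apply_of_ne {g k : Γ} (h : k ≠ g) : delta g k = 0 := by simp [delta_apply, h]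

theorem norm_delta (g : Γ) : ‖delta g‖ = 1 := by
  classical
  rw [delta, lp.norm_single (by norm_num)]
  simp

theorem inner_delta_left (g : Γ) (f : L2 Γ) : inner ℂ (delta g) f = f g := by
  classical
  rw [delta, lp.inner_single_left]
  simp

theorem hasSum_delta (f : L2 Γ) : HasSum (fun k => f k • delta k) f := by
  classical
  have h := lp.hasSum_single (by norm_num : (2 : ENNReal) ≠ ⊤) f
  convert h using 2 with k
  rw [delta, ← lp.single_smul]
  simp

theorem hasSum_matrix (y : L2 Γ →L[ℂ] L2 Γ) (f : L2 Γ) (t : Γ) :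
    HasSum (fun k => f k * y (delta k) t) (y f t) := by
  have h := ((innerSL ℂ (delta t)).comp y).hasSum (hasSum_delta f)
  simpa [inner_delta_left] using h

theorem clm_ext_delta {y z : L2 Γ →L[ℂ] L2 Γ} (h : ∀ s t, y (delta s) t = z (delta s) t) :
    y = z := by
  ext f t
  exact (hasSum_matrix y f t).unique (by simpa [h] using hasSum_matrix z f t)

theorem adjoint_delta_apply (x : L2 Γ →L[ℂ] L2 Γ) (g h : Γ) :
    star x (delta g) h = star (x (delta h) g) := by
  rw [← inner_delta_left, ← inner_delta_left, ContinuousLinearMap.star_eq_adjoint,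
    ContinuousLinearMap.adjoint_inner_right]
  exact (inner_conj_symm _ _).symm

/-- Restriction of an element of `ℓ²(Γ)` to the set `S`, as a bounded operator. -/
noncomputable def restrict (S : Set Γ) : L2 Γ →L[ℂ] L2 Γ :=
  LinearMap.mkContinuous
    { toFun := fun f => ⟨S.indicator f, (lp.memℓp f).mono' fun k => norm_indicator_le_norm_self _ _⟩
      map_add' := fun f g => lp.ext (Set.indicator_add S f g)
      map_smul' := fun c f => lp.ext (Set.indicator_const_smul S c f) } 1 (fun f => by
        rw [one_mul]
        refine (pow_le_pow_iff_left₀ (norm_nonneg _) (norm_nonneg _) two_ne_zero).1 ?_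
        refine hasSum_le (fun k => ?_) (hasSum_norm_sq _) (hasSum_norm_sq f)
        exact pow_le_pow_left₀ (norm_nonneg _) (norm_indicator_le_norm_self _ _) 2)

theorem restrict_apply (S : Set Γ) (f : L2 Γ) (k : Γ) : restrict S f k = S.indicator f k := rfl

theorem restrict_apply_mem {S : Set Γ} (f : L2 Γ) {k : Γ} (h : k ∈ S) : restrict S f k = f k := by
  simp [restrict_apply, h]

theorem restrict_apply_notMem {S : Set Γ} (f : L2 Γ) {k : Γ} (h : k ∉ S) :
    restrict S f k = 0 := by
  simp [restrict_apply, h]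

theorem norm_restrict_le (S : Set Γ) (f : L2 Γ) : ‖restrict S f‖ ≤ ‖f‖ := by
  refine (pow_le_pow_iff_left₀ (norm_nonneg _) (norm_nonneg _) two_ne_zero).1 ?_
  refine hasSum_le (fun k => ?_) (hasSum_norm_sq _) (hasSum_norm_sq f)
  exact pow_le_pow_left₀ (norm_nonneg _) (norm_indicator_le_norm_self _ _) 2

theorem restrict_delta_mem {S : Set Γ} {g : Γ} (h : g ∈ S) : restrict S (delta g) = delta g := by
  ext k
  by_cases hk : k ∈ S
  · rw [restrict_apply_mem _ hk]
  · rw [restrict_apply_notMem _ hk, delta_apply_of_ne]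
    rintro rfl
    exact hk h

theorem restrict_of_support {S : Set Γ} {f : L2 Γ} (hf : ∀ k ∉ S, f k = 0) :
    restrict S f = f := by
  ext k
  by_cases hk : k ∈ S
  · rw [restrict_apply_mem _ hk]
  · rw [restrict_apply_notMem _ hk, hf k hk]

theorem restrict_add_restrict_compl (S : Set Γ) (f : L2 Γ) :
    restrict S f + restrict Sᶜ f = f := by
  ext k
  exact congrFun (Set.indicator_self_add_compl S (f : Γ → ℂ)) k

theorem norm_sq_eq_restrict_add (S : Set Γ) (f : L2 Γ) :
    ‖f‖ ^ 2 = ‖restrict S f‖ ^ 2 + ‖restrict Sᶜ f‖ ^ 2 := by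
  refine (hasSum_norm_sq f).unique ?_
  convert (hasSum_norm_sq (restrict S f)).add (hasSum_norm_sq (restrict Sᶜ f)) using 2 with k
  by_cases hk : k ∈ S <;> simp [restrict_apply, hk]

end Coordinates

/-! ### The block diagonal part of an operator -/

section Pinch

variable {Γ : Type u} {ι : Type v}

theorem summable_prod_norm_sq {F : ι → L2 Γ} {a : ℝ} (h : HasSum (fun c => ‖F c‖ ^ 2) a) :
    HasSum (fun p : ι × Γ => ‖F p.1 p.2‖ ^ 2) a := by
  have h1 : Summable fun p : ι × Γ => ‖F p.1 p.2‖ ^ 2 := by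
    refine (summable_prod_of_nonneg (f := fun p : ι × Γ => ‖F p.1 p.2‖ ^ 2)
      fun _ => sq_nonneg _).2 ⟨fun c => (hasSum_norm_sq (F c)).summable, ?_⟩
    refine h.summable.congr fun c => ?_
    exact (hasSum_norm_sq (F c)).tsum_eq.symm
  have h2 := HasSum.prod_fiberwise (f := fun p : ι × Γ => ‖F p.1 p.2‖ ^ 2) h1.hasSum
    fun c => hasSum_norm_sq (F c)
  rw [h.unique h2]
  exact h1.hasSum

theorem hasSum_prod_swap {α β E : Type*} [AddCommMonoid E] [TopologicalSpace E] {F : α × β → E}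
    {a : E} (h : HasSum F a) : HasSum (fun p : β × α => F (p.2, p.1)) a :=
  (Equiv.prodComm β α).hasSum_iff.mpr h

/-- For fixed `k` only the term `c = q k` survives, so the nonnegative double series sums to `‖f‖²`;
summing in the other order gives the claim. -/
theorem hasSum_fiber_norm_sq (q : Γ → ι) (f : L2 Γ) :
    HasSum (fun c => ‖restrict {j | q j = c} f‖ ^ 2) (‖f‖ ^ 2) := by
  have h1 : ∀ k, HasSum (fun c => ‖restrict {j | q j = c} f k‖ ^ 2) (‖f k‖ ^ 2) := by
    intro k
    have := hasSum_single (f := fun c => ‖restrict {j | q j = c} f k‖ ^ 2) (q k) (fun c hc => by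
      rw [restrict_apply_notMem _ (by simpa using hc.symm)]; simp)
    rwa [restrict_apply_mem _ (by simp)] at this
  have h2 : Summable fun p : Γ × ι => ‖restrict {j | q j = p.2} f p.1‖ ^ 2 := by
    refine (summable_prod_of_nonneg (f := fun p : Γ × ι => ‖restrict {j | q j = p.2} f p.1‖ ^ 2)
      fun _ => sq_nonneg _).2 ⟨fun k => (h1 k).summable, ?_⟩
    refine (hasSum_norm_sq f).summable.congr fun k => ?_
    exact (h1 k).tsum_eq.symm
  have h3 : HasSum (fun p : Γ × ι => ‖restrict {j | q j = p.2} f p.1‖ ^ 2) (‖f‖ ^ 2) := by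
    have h := HasSum.prod_fiberwise (f := fun p : Γ × ι => ‖restrict {j | q j = p.2} f p.1‖ ^ 2)
      h2.hasSum h1
    rw [(hasSum_norm_sq f).unique h]
    exact h2.hasSum
  have h4 : HasSum (fun p : ι × Γ => ‖restrict {j | q j = p.1} f p.2‖ ^ 2) (‖f‖ ^ 2) :=
    hasSum_prod_swap (F := fun p : Γ × ι => ‖restrict {j | q j = p.2} f p.1‖ ^ 2) h3
  exact HasSum.prod_fiberwise (f := fun p : ι × Γ => ‖restrict {j | q j = p.1} f p.2‖ ^ 2) h4
    fun c => hasSum_norm_sq (restrict {j | q j = c} f)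

theorem summable_block (q : Γ → ι) (x : L2 Γ →L[ℂ] L2 Γ) (f : L2 Γ) :
    Summable (fun p : ι × Γ => ‖x (restrict {j | q j = p.1} f) p.2‖ ^ 2) ∧
      ∑' p : ι × Γ, ‖x (restrict {j | q j = p.1} f) p.2‖ ^ 2 ≤ (‖x‖ * ‖f‖) ^ 2 := by
  have hb : ∀ c, ‖x (restrict {j | q j = c} f)‖ ^ 2 ≤ ‖x‖ ^ 2 * ‖restrict {j | q j = c} f‖ ^ 2 := by
    intro c
    rw [← mul_pow]
    exact pow_le_pow_left₀ (norm_nonneg _) (x.le_opNorm _) 2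
  have hs := (hasSum_fiber_norm_sq q f).mul_left (‖x‖ ^ 2)
  have hs' : Summable fun c => ‖x (restrict {j | q j = c} f)‖ ^ 2 :=
    Summable.of_nonneg_of_le (fun _ => sq_nonneg _) hb hs.summable
  have h1 := summable_prod_norm_sq (F := fun c => x (restrict {j | q j = c} f)) hs'.hasSum
  refine ⟨h1.summable, ?_⟩
  rw [mul_pow]
  exact h1.tsum_eq.trans_le (hasSum_le hb hs'.hasSum hs)

/-- The entries of the block diagonal part are the subfamily of the block family indexed by the
pairs `(q k, k)`. -/
theorem pinch_bound (q : Γ → ι) (x : L2 Γ →L[ℂ] L2 Γ) (f : L2 Γ) :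
    Summable (fun k => ‖x (restrict {j | q j = q k} f) k‖ ^ 2) ∧
      ∑' k, ‖x (restrict {j | q j = q k} f) k‖ ^ 2 ≤ (‖x‖ * ‖f‖) ^ 2 := by
  have hi : Function.Injective fun k : Γ => (q k, k) := fun a b h => congrArg Prod.snd h
  obtain ⟨h1, h2⟩ := summable_block q x f
  have h3 := h1.comp_injective hi
  exact ⟨h3, (tsum_comp_le_tsum_of_inj h1 (fun _ => sq_nonneg _) hi).trans h2⟩

/-- The block diagonal part of the operator `x`, with respect to the partition of `Γ` into the
fibres of `q`. -/
noncomputable def pinch (q : Γ → ι) (x : L2 Γ →L[ℂ] L2 Γ) : L2 Γ →L[ℂ] L2 Γ :=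
  LinearMap.mkContinuous
    { toFun := fun f => ⟨fun k => x (restrict {j | q j = q k} f) k,
        memℓp_of_summable_sq (pinch_bound q x f).1⟩
      map_add' := fun f g => by ext k; simp; rfl
      map_smul' := fun c f => by ext k; simp } ‖x‖ (fun f => by
        refine (pow_le_pow_iff_left₀ (norm_nonneg _) (by positivity) two_ne_zero).1 ?_
        refine le_trans (le_of_eq ?_) (pinch_bound q x f).2
        exact (hasSum_norm_sq _).tsum_eq.symm)

theorem pinch_apply (q : Γ → ι) (x : L2 Γ →L[ℂ] L2 Γ) (f : L2 Γ) (k : Γ) :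
    pinch q x f k = x (restrict {j | q j = q k} f) k := rfl

/-- The absolutely convergent double series of `inner (A c k) (B c k)` is summed in both orders.
Only `A c` has to be supported in the fibre over `c`, so `B c` may be `x` applied to a block of `f`.
-/
theorem hasSum_inner_of_fiber (q : Γ → ι) {A B : ι → L2 Γ} {f g : L2 Γ}
    (hsA : Summable fun c => ‖A c‖ ^ 2) (hsB : Summable fun c => ‖B c‖ ^ 2)
    (hA : ∀ c k, q k ≠ c → A c k = 0) (hf : ∀ k, A (q k) k = f k) (hg : ∀ k, B (q k) k = g k) :
    HasSum (fun c => inner ℂ (A c) (B c)) (inner ℂ f g) := by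
  have hF : Summable fun p : ι × Γ => inner ℂ (A p.1 p.2) (B p.1 p.2) := by
    refine Summable.of_norm_bounded ((summable_prod_norm_sq hsA.hasSum).summable.add
      (summable_prod_norm_sq hsB.hasSum).summable) fun p => ?_
    refine (norm_inner_le_norm (𝕜 := ℂ) (A p.1 p.2) (B p.1 p.2)).trans ?_
    nlinarith [two_mul_le_add_sq ‖A p.1 p.2‖ ‖B p.1 p.2‖, sq_nonneg ‖A p.1 p.2‖,
      sq_nonneg ‖B p.1 p.2‖]
  have h1 := HasSum.prod_fiberwise (f := fun p : ι × Γ => inner ℂ (A p.1 p.2) (B p.1 p.2))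
    hF.hasSum fun c => lp.hasSum_inner (A c) (B c)
  have h2 : HasSum (fun p : Γ × ι => inner ℂ (A p.2 p.1) (B p.2 p.1))
      (∑' p : ι × Γ, inner ℂ (A p.1 p.2) (B p.1 p.2)) :=
    hasSum_prod_swap (F := fun p : ι × Γ => inner ℂ (A p.1 p.2) (B p.1 p.2)) hF.hasSum
  have h3 : ∀ k, HasSum (fun c => inner ℂ (A c k) (B c k)) (inner ℂ (f k) (g k)) := fun k => by
    have h := hasSum_single (f := fun c => inner ℂ (A c k) (B c k)) (q k) (fun c hc => by
      simp only [hA c k hc.symm, inner_zero_left])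
    simpa only [hf, hg] using h
  have h4 := HasSum.prod_fiberwise (f := fun p : Γ × ι => inner ℂ (A p.2 p.1) (B p.2 p.1)) h2 h3
  rw [(lp.hasSum_inner f g).unique h4]
  exact h1

theorem hasSum_inner_pinch (q : Γ → ι) (x : L2 Γ →L[ℂ] L2 Γ) (f : L2 Γ) :
    HasSum (fun c => inner ℂ (restrict {j | q j = c} f) (x (restrict {j | q j = c} f)))
      (inner ℂ f (pinch q x f)) := by
  have hs := (hasSum_fiber_norm_sq q f).summable
  refine hasSum_inner_of_fiber q (A := fun c => restrict {j | q j = c} f)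
    (B := fun c => x (restrict {j | q j = c} f)) hs ?_
    (fun c k h => restrict_apply_notMem f h) (fun k => restrict_apply_mem f rfl) (fun k => rfl)
  refine Summable.of_nonneg_of_le (fun _ => sq_nonneg _) (fun c => ?_) (hs.mul_left (‖x‖ ^ 2))
  rw [← mul_pow]
  exact pow_le_pow_left₀ (norm_nonneg _) (x.le_opNorm _) 2

/-- The quadratic form of the block diagonal part is the sum of the forms of `x` at the blocks of
`f`. -/
theorem isPositive_pinch (q : Γ → ι) {x : L2 Γ →L[ℂ] L2 Γ} (hx : x.IsPositive) :
    (pinch q x).IsPositive := by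
  open scoped ComplexOrder in
  have h : ∀ f, 0 ≤ inner ℂ f (pinch q x f) := fun f =>
    (hasSum_inner_pinch q x f).nonneg fun c => hx.inner_nonneg_right _
  rw [ContinuousLinearMap.isPositive_iff_complex]
  intro f
  obtain ⟨h0, h1⟩ := Complex.nonneg_iff.1 (h f)
  have key : inner ℂ (pinch q x f) f = inner ℂ f (pinch q x f) := by
    rw [← inner_conj_symm, Complex.conj_eq_iff_im.2 h1.symm]
  rw [key]
  exact ⟨Complex.ext rfl h1, h0⟩

end Pinch

/-! ### Right translations and the description of `VN(G)` by coordinates -/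

section Translations

variable {Γ : Type u} [Group Γ]

theorem leftRegular_apply (g : Γ) (f : L2 Γ) (k : Γ) : leftRegular g f k = f (g⁻¹ * k) := rfl

theorem norm_leftRegular_apply (g : Γ) (f : L2 Γ) : ‖leftRegular g f‖ = ‖f‖ :=
  (leftRegularIsometry g).norm_map f

theorem leftRegular_delta (g h : Γ) : leftRegular g (delta h) = delta (g * h) := by
  classical
  ext k
  simp [leftRegular_apply, delta_apply, inv_mul_eq_iff_eq_mul]

theorem star_leftRegular (g : Γ) : star (leftRegular g) = leftRegular g⁻¹ := by
  classical
  refine clm_ext_delta fun s t => ?_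
  rw [adjoint_delta_apply, leftRegular_delta, leftRegular_delta, delta_apply, delta_apply]
  by_cases h : s = g * t
  · simp [h]
  · rw [if_neg h, if_neg, star_zero]
    rintro rfl
    simp at h

theorem hasSum_mul_right {β : Type*} [AddCommMonoid β] [TopologicalSpace β] {F : Γ → β} {a : β}
    (h : HasSum F a) (s : Γ) : HasSum (fun g => F (g * s)) a :=
  (Equiv.mulRight s).hasSum_iff.mpr h

theorem memℓp_rightTranslate (g : Γ) (f : L2 Γ) :
    Memℓp (fun h : Γ => (f : Γ → ℂ) (h * g)) 2 :=
  memℓp_of_summable_sq (hasSum_mul_right (hasSum_norm_sq f) g).summable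

/-- The right regular representation: `(rightRegular g f) h = f (h g)`. -/
noncomputable def rightRegularIsometry (g : Γ) : L2 Γ →ₗᵢ[ℂ] L2 Γ where
  toFun f := ⟨fun h => (f : Γ → ℂ) (h * g), memℓp_rightTranslate g f⟩
  map_add' f₁ f₂ := by ext h; rfl
  map_smul' c f := by ext h; rfl
  norm_map' f := by
    refine (pow_left_inj₀ (norm_nonneg _) (norm_nonneg _) two_ne_zero).1 ?_
    exact (hasSum_norm_sq _).unique (hasSum_mul_right (hasSum_norm_sq f) g)

/-- The right regular representation, as bounded operators on `ℓ²(Γ)`. -/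
noncomputable def rightRegular (g : Γ) : L2 Γ →L[ℂ] L2 Γ :=
  (rightRegularIsometry g).toContinuousLinearMap

theorem rightRegular_apply (g : Γ) (f : L2 Γ) (k : Γ) : rightRegular g f k = f (k * g) := rfl

theorem rightRegular_delta (g h : Γ) : rightRegular g (delta h) = delta (h * g⁻¹) := by
  classical
  ext k
  simp [rightRegular_apply, delta_apply, eq_mul_inv_iff_mul_eq]

/-- An operator commuting with right translations is determined by its matrix coefficients in
the column of the unit. -/
theorem apply_delta_of_commute {z : L2 Γ →L[ℂ] L2 Γ}
    (hz : ∀ g, z * rightRegular g = rightRegular g * z) (s t : Γ) :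
    z (delta s) t = z (delta 1) (t * s⁻¹) := by
  have h := DFunLike.congr_fun (hz s⁻¹) (delta 1)
  simp only [mul_apply_eq_comp, rightRegular_delta, inv_inv, one_mul] at h
  rw [h, rightRegular_apply]

theorem eq_of_apply_delta_one {y z : L2 Γ →L[ℂ] L2 Γ}
    (hy : ∀ g, y * rightRegular g = rightRegular g * y)
    (hz : ∀ g, z * rightRegular g = rightRegular g * z) (h : y (delta 1) = z (delta 1)) :
    y = z :=
  clm_ext_delta fun s t => by
    rw [apply_delta_of_commute hy, apply_delta_of_commute hz, h]

theorem hasSum_inv_mul {F : Γ → ℂ} {a : ℂ} (h : HasSum F a) (t : Γ) :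
    HasSum (fun g => F (g⁻¹ * t)) a :=
  ((Equiv.inv Γ).trans (Equiv.mulRight t)).hasSum_iff.mpr h

/-- Formally `z` is the sum of `z(g) λ(g)` over `g ∈ G`, and `y` commutes with each `λ(g)`. Since
this series need not converge as operators, matrix coefficients of `y z` and `z y` are compared:
indexed by `g`, the two scalar series agree term by term. -/
theorem commute_of_support (G : Subgroup Γ) {y z : L2 Γ →L[ℂ] L2 Γ}
    (hz : ∀ g, z * rightRegular g = rightRegular g * z) (hG : ∀ k ∉ G, z (delta 1) k = 0)
    (hy : ∀ g ∈ G, leftRegular g * y = y * leftRegular g) : y * z = z * y := by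
  refine clm_ext_delta fun s t => ?_
  have h1 : HasSum (fun g => y (delta s) (g⁻¹ * t) * z (delta (g⁻¹ * t)) t) (z (y (delta s)) t) :=
    hasSum_inv_mul (F := fun k => y (delta s) k * z (delta k) t) (hasSum_matrix z (y (delta s)) t) t
  have h2 : HasSum (fun g => z (delta s) (g * s) * y (delta (g * s)) t) (y (z (delta s)) t) :=
    hasSum_mul_right (F := fun k => z (delta s) k * y (delta k) t) (hasSum_matrix y (z (delta s)) t) s
  have h3 : ∀ g, z (delta s) (g * s) * y (delta (g * s)) t =
      y (delta s) (g⁻¹ * t) * z (delta (g⁻¹ * t)) t := fun g => by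
    rw [apply_delta_of_commute hz s, apply_delta_of_commute hz (g⁻¹ * t), mul_inv_cancel_right,
      mul_inv_rev, inv_inv, mul_inv_cancel_left]
    by_cases hg : g ∈ G
    · have h := DFunLike.congr_fun (hy g hg) (delta s)
      simp only [mul_apply_eq_comp, leftRegular_delta] at h
      rw [← h, leftRegular_apply, mul_comm]
    · rw [hG g hg, zero_mul, mul_zero]
  rw [funext h3] at h2
  change y (z (delta s)) t = z (y (delta s)) t
  exact h2.unique h1

theorem rightRegular_mem_centralizer (G : Subgroup Γ) (g : Γ) :
    rightRegular g ∈ StarSubalgebra.centralizer ℂ (leftRegular '' (G : Set Γ)) := by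
  rw [StarSubalgebra.mem_centralizer_iff]
  rintro _ ⟨h, -, rfl⟩
  rw [star_leftRegular]
  constructor <;>
  · ext f k
    simp [leftRegular_apply, rightRegular_apply, mul_assoc]

theorem restrict_mem_centralizer (G : Subgroup Γ) :
    restrict (G : Set Γ) ∈ StarSubalgebra.centralizer ℂ (leftRegular '' (G : Set Γ)) := by
  have h : ∀ g ∈ G, leftRegular g * restrict (G : Set Γ) = restrict (G : Set Γ) * leftRegular g := by
    intro g hg
    ext f k
    simp only [mul_apply_eq_comp, leftRegular_apply, restrict_apply]
    have hgk : g⁻¹ * k ∈ G ↔ k ∈ G := G.mul_mem_cancel_left (G.inv_mem hg)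
    by_cases hk : k ∈ G <;> simp [hk, hgk, leftRegular_apply]
  rw [StarSubalgebra.mem_centralizer_iff]
  rintro _ ⟨g, hg, rfl⟩
  rw [star_leftRegular]
  exact ⟨h g hg, h _ (G.inv_mem hg)⟩

/-- The right translations and the projection onto `ℓ²(G)` lie in the commutant of `λ(G)`, and
commuting with them yields the two conditions. The converse is `commute_of_support`. -/
theorem mem_VN_iff (G : Subgroup Γ) (z : L2 Γ →L[ℂ] L2 Γ) :
    z ∈ VN G ↔ (∀ g, z * rightRegular g = rightRegular g * z) ∧
      ∀ k ∉ G, z (delta 1) k = 0 := by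
  change z ∈ StarSubalgebra.centralizer ℂ
    (StarSubalgebra.centralizer ℂ (leftRegular '' (G : Set Γ)) : Set (L2 Γ →L[ℂ] L2 Γ)) ↔ _
  rw [StarSubalgebra.mem_centralizer_iff]
  constructor
  · intro h
    refine ⟨fun g => ((h _ (rightRegular_mem_centralizer G g)).1).symm, fun k hk => ?_⟩
    have h1 := DFunLike.congr_fun (h _ (restrict_mem_centralizer G)).1 (delta 1)
    simp only [mul_apply_eq_comp] at h1
    rw [restrict_delta_mem (by exact G.one_mem)] at h1
    rw [← h1, restrict_apply_notMem _ (by exact hk)]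
  · rintro ⟨h1, h2⟩ y hy
    have h : ∀ y ∈ StarSubalgebra.centralizer ℂ (leftRegular '' (G : Set Γ)), y * z = z * y := by
      intro y hy
      rw [StarSubalgebra.mem_centralizer_iff] at hy
      exact commute_of_support G h1 h2 fun g hg => (hy _ ⟨g, hg, rfl⟩).1
    exact ⟨h y hy, h _ (star_mem hy)⟩

theorem mem_VN_top_iff (z : L2 Γ →L[ℂ] L2 Γ) :
    z ∈ VN (⊤ : Subgroup Γ) ↔ ∀ g, z * rightRegular g = rightRegular g * z := by
  simp [mem_VN_iff]

theorem leftRegular_mem_VN {G : Subgroup Γ} {g : Γ} (hg : g ∈ G) : leftRegular g ∈ VN G := by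
  rw [mem_VN_iff]
  refine ⟨fun h => ?_, fun k hk => ?_⟩
  · ext f k
    simp [leftRegular_apply, rightRegular_apply, mul_assoc]
  · rw [leftRegular_delta, mul_one]
    exact delta_apply_of_ne fun h => hk (h ▸ hg)

end Translations

/-! ### The trace and the `2`-norm -/

section Trace

variable {Γ : Type u} [Group Γ]

theorem M_commute (x : M Γ) (g : Γ) :
    (x : L2 Γ →L[ℂ] L2 Γ) * rightRegular g = rightRegular g * (x : L2 Γ →L[ℂ] L2 Γ) :=
  (mem_VN_top_iff _).1 x.2 g

/-- The vector `x δ_e`. -/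
noncomputable def vec (x : M Γ) : L2 Γ := (x : L2 Γ →L[ℂ] L2 Γ) (delta 1)

theorem vec_injective : Function.Injective (vec : M Γ → L2 Γ) := fun x y h =>
  Subtype.ext (eq_of_apply_delta_one (M_commute x) (M_commute y) h)

theorem vec_sub (x y : M Γ) : vec (x - y) = vec x - vec y := rfl

theorem vec_mul (x y : M Γ) : vec (x * y) = (x : L2 Γ →L[ℂ] L2 Γ) (vec y) := rfl

theorem tr_star_mul (x y : M Γ) : tr (star x * y) = inner ℂ (vec x) (vec y) := by
  change inner ℂ (delta 1) (star (x : L2 Γ →L[ℂ] L2 Γ) (vec y)) = _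
  rw [ContinuousLinearMap.star_eq_adjoint, ContinuousLinearMap.adjoint_inner_right]
  rfl

theorem tr_eq_vec_apply (x : M Γ) : tr x = vec x 1 := inner_delta_left 1 (vec x)

theorem normTwo_eq (x : M Γ) : normTwo x = ‖vec x‖ := by
  rw [normTwo, tr_star_mul, inner_self_eq_norm_sq_to_K]
  rw [← RCLike.ofReal_pow]
  exact Real.sqrt_sq (norm_nonneg _)

theorem norm_vec_le (x : M Γ) : ‖vec x‖ ≤ ‖(x : L2 Γ →L[ℂ] L2 Γ)‖ := by
  simpa only [norm_delta, mul_one, vec] using (x : L2 Γ →L[ℂ] L2 Γ).le_opNorm (delta 1)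

theorem hasSum_tr_mul (x y : M Γ) : HasSum (fun g => vec x g⁻¹ * vec y g) (tr (x * y)) := by
  have h := hasSum_matrix (x : L2 Γ →L[ℂ] L2 Γ) (vec y) 1
  rw [tr_eq_vec_apply, vec_mul]
  convert h using 2 with g
  rw [apply_delta_of_commute (M_commute x), one_mul, mul_comm]
  rfl

/-- The series for `tr (x * y)` and `tr (y * x)` are exchanged by `g ↦ g⁻¹`. -/
theorem tr_mul_comm (x y : M Γ) : tr (x * y) = tr (y * x) := by
  refine (hasSum_tr_mul x y).unique ?_
  have h := (Equiv.inv Γ).hasSum_iff.mpr (hasSum_tr_mul y x)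
  convert h using 2 with g
  simp [mul_comm]

end Trace

/-! ### Trace preserving conditional expectations -/

section CondExp

variable {Γ : Type u} [Group Γ] {N : VonNeumannAlgebra (L2 Γ)} {E : M Γ →ₗ[ℂ] M Γ}

/-- This says that `E x - x` is orthogonal to `N`, so that `E` acts on vectors as an orthogonal
projection; it follows from trace preservation and `E (a* x) = a* E x`. -/
theorem IsCondExp.inner_vec (hE : IsCondExp N E) {a : M Γ} (ha : (a : L2 Γ →L[ℂ] L2 Γ) ∈ N)
    (x : M Γ) : inner ℂ (vec a) (vec (E x)) = inner ℂ (vec a) (vec x) := by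
  rw [← tr_star_mul, ← tr_star_mul, ← hE.tr_eq (star a * x)]
  have h := hE.bimodule (star a) 1 x (star_mem (s := N) ha) (one_mem N)
  rw [mul_one, mul_one] at h
  rw [h]

/-- The difference `E x - E' x` lies in `N` and is orthogonal to `N`. -/
theorem IsCondExp.unique {E' : M Γ →ₗ[ℂ] M Γ} (hE : IsCondExp N E) (hE' : IsCondExp N E') :
    E = E' := by
  refine LinearMap.ext fun x => ?_
  have hm : ((E x - E' x : M Γ) : L2 Γ →L[ℂ] L2 Γ) ∈ N := sub_mem (hE.mem x) (hE'.mem x)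
  have h : inner ℂ (vec (E x - E' x)) (vec (E x - E' x)) = 0 := by
    conv_lhs => arg 3; rw [vec_sub]
    rw [inner_sub_right, hE.inner_vec hm, hE'.inner_vec hm, sub_self]
  rw [inner_self_eq_zero] at h
  rw [← sub_eq_zero]
  exact vec_injective h

theorem IsCondExp.condExp_eq (hE : IsCondExp N E) : condExp N = E := by
  have h : ∃ E, IsCondExp N E := ⟨E, hE⟩
  rw [condExp, dif_pos h]
  exact h.choose_spec.unique hE

theorem IsCondExp.norm_sq_vec_sub (hE : IsCondExp N E) (x : M Γ) :
    ‖vec (E x - x)‖ ^ 2 = ‖vec x‖ ^ 2 - ‖vec (E x)‖ ^ 2 := by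
  have h := hE.inner_vec (hE.mem x) x
  rw [vec_sub, @norm_sub_sq ℂ, ← h, inner_self_eq_norm_sq]
  ring

theorem IsCondExp.norm_vec_le (hE : IsCondExp N E) (x : M Γ) : ‖vec (E x)‖ ≤ ‖vec x‖ := by
  refine (pow_le_pow_iff_left₀ (norm_nonneg _) (norm_nonneg _) two_ne_zero).1 ?_
  have h := hE.norm_sq_vec_sub x
  nlinarith [sq_nonneg ‖vec (E x - x)‖]

theorem bddAbove_unitBallValues_sub {N' : VonNeumannAlgebra (L2 Γ)} {E' : M Γ →ₗ[ℂ] M Γ}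
    (hE : IsCondExp N E) (hE' : IsCondExp N' E') : BddAbove (unitBallValues (E' - E)) := by
  refine ⟨2, ?_⟩
  rintro _ ⟨x, hx, rfl⟩
  rw [normTwo_eq, LinearMap.sub_apply, vec_sub]
  have h1 := (hE.norm_vec_le x).trans ((GroupVN.norm_vec_le x).trans hx)
  have h2 := (hE'.norm_vec_le x).trans ((GroupVN.norm_vec_le x).trans hx)
  linarith [norm_sub_le (vec (E' x)) (vec (E x))]

end CondExp

/-! ### The conditional expectation onto `VN(G)` -/

section Subgroup

variable {Γ : Type u} [Group Γ]

/-- The right coset `G k`, as an element of the quotient. -/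
def rightCoset (G : Subgroup Γ) (k : Γ) : Quotient (QuotientGroup.rightRel G) := Quotient.mk _ k

theorem rightCoset_eq_iff (G : Subgroup Γ) {j k : Γ} :
    rightCoset G j = rightCoset G k ↔ k * j⁻¹ ∈ G := by
  rw [rightCoset, rightCoset, Quotient.eq, QuotientGroup.rightRel_apply]

/-- Right translations permute the right cosets `G k`, which is why these are the blocks. -/
theorem pinch_commute (G : Subgroup Γ) {x : L2 Γ →L[ℂ] L2 Γ}
    (hx : ∀ g, x * rightRegular g = rightRegular g * x) (g : Γ) :
    pinch (rightCoset G) x * rightRegular g = rightRegular g * pinch (rightCoset G) x := by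
  ext f k
  simp only [mul_apply_eq_comp, rightRegular_apply, pinch_apply]
  have h1 : restrict {j | rightCoset G j = rightCoset G k} (rightRegular g f) =
      rightRegular g (restrict {j | rightCoset G j = rightCoset G (k * g)} f) := by
    ext j
    have hj : rightCoset G j = rightCoset G k ↔ rightCoset G (j * g) = rightCoset G (k * g) := by
      simp [rightCoset_eq_iff]
    rw [rightRegular_apply]
    by_cases h : rightCoset G j = rightCoset G k
    · rw [restrict_apply_mem _ (by exact h), restrict_apply_mem _ (by exact hj.1 h),
        rightRegular_apply]
    · rw [restrict_apply_notMem _ (by exact h),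
        restrict_apply_notMem _ (by exact fun h' => h (hj.2 h'))]
  have h2 := DFunLike.congr_fun (hx g) (restrict {j | rightCoset G j = rightCoset G (k * g)} f)
  simp only [mul_apply_eq_comp] at h2
  rw [h1, h2, rightRegular_apply]

/-- Such an `f` lives in the single block `G`: its restriction to the coset of `k` is `f` or `0`
according to whether `k ∈ G`. -/
theorem pinch_of_support (G : Subgroup Γ) (x : L2 Γ →L[ℂ] L2 Γ) {f : L2 Γ}
    (hf : ∀ k ∉ G, f k = 0) : pinch (rightCoset G) x f = restrict (G : Set Γ) (x f) := by
  classical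
  ext k
  rw [pinch_apply]
  have key : ∀ k, restrict {j | rightCoset G j = rightCoset G k} f =
      if k ∈ G then f else 0 := by
    intro k
    ext j
    have hjk : j ∈ G → (rightCoset G j = rightCoset G k ↔ k ∈ G) := fun hj => by
      rw [rightCoset_eq_iff, G.mul_mem_cancel_right (G.inv_mem hj)]
    by_cases hj : j ∈ G
    · by_cases hk : k ∈ G
      · rw [restrict_apply_mem _ (by exact (hjk hj).2 hk), if_pos hk]
      · rw [restrict_apply_notMem _ (by exact fun h => hk ((hjk hj).1 h)), if_neg hk]
        rfl
    · have h0 : restrict {j | rightCoset G j = rightCoset G k} f j = 0 := by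
        by_cases h : rightCoset G j = rightCoset G k
        · rw [restrict_apply_mem _ (by exact h), hf j hj]
        · rw [restrict_apply_notMem _ (by exact h)]
      rw [h0]
      split_ifs
      · exact (hf j hj).symm
      · rfl
  rw [key]
  by_cases hk : k ∈ G
  · rw [if_pos hk, restrict_apply_mem _ (by exact hk)]
  · rw [if_neg hk, restrict_apply_notMem _ (by exact hk), map_zero]
    rfl

/-- The conditional expectation of `VN(Γ)` onto `VN(G)`: the block diagonal part
with respect to the right cosets of `G`. -/
noncomputable def subgroupExp (G : Subgroup Γ) : M Γ →ₗ[ℂ] M Γ where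
  toFun x := ⟨pinch (rightCoset G) (x : L2 Γ →L[ℂ] L2 Γ),
    (mem_VN_top_iff _).2 (pinch_commute G (M_commute x))⟩
  map_add' _ _ := rfl
  map_smul' _ _ := rfl

theorem delta_one_support (G : Subgroup Γ) : ∀ k ∉ G, delta (1 : Γ) k = 0 := fun _ hk =>
  delta_apply_of_ne fun h => hk (h ▸ G.one_mem)

theorem vec_subgroupExp (G : Subgroup Γ) (x : M Γ) :
    vec (subgroupExp G x) = restrict (G : Set Γ) (vec x) :=
  pinch_of_support G _ (delta_one_support G)

theorem coe_mem_VN_iff (G : Subgroup Γ) (x : M Γ) :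
    (x : L2 Γ →L[ℂ] L2 Γ) ∈ VN G ↔ ∀ k ∉ G, vec x k = 0 := by
  rw [mem_VN_iff]
  exact and_iff_right (M_commute x)

theorem restrict_comm_of_mem_VN {G : Subgroup Γ} {a : L2 Γ →L[ℂ] L2 Γ} (ha : a ∈ VN G)
    (f : L2 Γ) : restrict (G : Set Γ) (a f) = a (restrict (G : Set Γ) f) := by
  have h := StarSubalgebra.mem_centralizer_iff ℂ |>.1 ha
  exact DFunLike.congr_fun (h _ (restrict_mem_centralizer G)).1 f

/-- Everything but positivity is checked on the vector at `δ_e`. For the bimodule property, `b δ_e`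
is supported in `G`, and `a` commutes with the projection onto `ℓ²(G)`. -/
theorem isCondExp_subgroupExp (G : Subgroup Γ) : IsCondExp (VN G) (subgroupExp G) where
  mem x := by
    rw [coe_mem_VN_iff, vec_subgroupExp]
    exact fun k hk => restrict_apply_notMem _ hk
  fix x hx := by
    rw [coe_mem_VN_iff] at hx
    apply vec_injective
    rw [vec_subgroupExp, restrict_of_support hx]
  pos x hx := isPositive_pinch _ hx
  bimodule a b x ha hb := by
    apply vec_injective
    have h : vec (subgroupExp G x * b) = restrict (G : Set Γ) (vec (x * b)) :=
      pinch_of_support G _ ((coe_mem_VN_iff G b).1 hb)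
    rw [vec_subgroupExp, mul_assoc, mul_assoc, vec_mul, vec_mul a (subgroupExp G x * b), h,
      restrict_comm_of_mem_VN ha]
  tr_eq x := by
    rw [tr_eq_vec_apply, tr_eq_vec_apply, vec_subgroupExp, restrict_apply_mem _ G.one_mem]

end Subgroup

/-! ### Conjugation by a unitary -/

section Conj

variable {Γ : Type u} [Group Γ] {N : VonNeumannAlgebra (L2 Γ)} {E : M Γ →ₗ[ℂ] M Γ}

theorem star_unitary_mul_cancel (u : unitary (M Γ)) (z : M Γ) :
    star (u : M Γ) * ((u : M Γ) * z) = z := by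
  rw [← mul_assoc, Unitary.coe_star_mul_self, one_mul]

theorem unitary_mul_star (u : unitary (M Γ)) : (u : M Γ) * star (u : M Γ) = 1 :=
  Unitary.mul_star_self_of_mem u.2

theorem unitary_mul_star_cancel (u : unitary (M Γ)) (z : M Γ) :
    (u : M Γ) * (star (u : M Γ) * z) = z := by
  rw [← mul_assoc, unitary_mul_star, one_mul]

theorem coe_mem_conj_iff (u : unitary (M Γ)) (z : M Γ) :
    (z : L2 Γ →L[ℂ] L2 Γ) ∈ conj u N ↔
      ((star (u : M Γ) * z * u : M Γ) : L2 Γ →L[ℂ] L2 Γ) ∈ N := by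
  set U : unitary (L2 Γ →L[ℂ] L2 Γ) := ⟨((u : M Γ) : L2 Γ →L[ℂ] L2 Γ), unitary_coe_mem u⟩ with hU
  have h : (z : L2 Γ →L[ℂ] L2 Γ) ∈ conj u N ↔
      ∃ y ∈ N, Unitary.conjStarAlgAut ℂ (L2 Γ →L[ℂ] L2 Γ) U y = z := Iff.rfl
  rw [h]
  have h2 : ((star (u : M Γ) * z * u : M Γ) : L2 Γ →L[ℂ] L2 Γ) =
      (Unitary.conjStarAlgAut ℂ (L2 Γ →L[ℂ] L2 Γ) U).symm z := by
    rw [Unitary.conjStarAlgAut_symm_apply]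
    rfl
  rw [h2]
  constructor
  · rintro ⟨y, hy, hyz⟩
    rw [← hyz, StarAlgEquiv.symm_apply_apply]
    exact hy
  · exact fun h => ⟨_, h, StarAlgEquiv.apply_symm_apply _ _⟩

theorem tr_conj (u : unitary (M Γ)) (x : M Γ) : tr ((u : M Γ) * x * star (u : M Γ)) = tr x := by
  rw [tr_mul_comm, star_unitary_mul_cancel]

theorem tr_star_conj (u : unitary (M Γ)) (x : M Γ) :
    tr (star (u : M Γ) * x * (u : M Γ)) = tr x := by
  rw [tr_mul_comm, unitary_mul_star_cancel]

theorem norm_vec_conj (u : unitary (M Γ)) (x : M Γ) :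
    ‖vec ((u : M Γ) * x * star (u : M Γ))‖ = ‖vec x‖ := by
  rw [← normTwo_eq, ← normTwo_eq, normTwo, normTwo]
  have h : star ((u : M Γ) * x * star (u : M Γ)) * ((u : M Γ) * x * star (u : M Γ)) =
      (u : M Γ) * (star x * x) * star (u : M Γ) := by
    simp only [star_mul, star_star, mul_assoc, star_unitary_mul_cancel]
  rw [h, tr_conj]

/-- The map `x ↦ u E(u* x u) u*`. -/
noncomputable def conjExp (u : unitary (M Γ)) (E : M Γ →ₗ[ℂ] M Γ) : M Γ →ₗ[ℂ] M Γ where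
  toFun x := (u : M Γ) * E (star (u : M Γ) * x * u) * star (u : M Γ)
  map_add' x y := by simp only [mul_add, add_mul, map_add]
  map_smul' c x := by simp only [mul_smul_comm, smul_mul_assoc, map_smul, RingHom.id_apply]

theorem conjExp_apply (u : unitary (M Γ)) (E : M Γ →ₗ[ℂ] M Γ) (x : M Γ) :
    conjExp u E x = (u : M Γ) * E (star (u : M Γ) * x * u) * star (u : M Γ) := rfl

theorem IsCondExp.conjExp (hE : IsCondExp N E) (u : unitary (M Γ)) :
    IsCondExp (conj u N) (conjExp u E) where
  mem x := by
    rw [coe_mem_conj_iff, conjExp_apply]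
    have h : star (u : M Γ) * (u * E (star (u : M Γ) * x * u) * star (u : M Γ)) * u =
        E (star (u : M Γ) * x * u) := by
      simp only [mul_assoc, star_unitary_mul_cancel, Unitary.coe_star_mul_self, mul_one]
    rw [h]
    exact hE.mem _
  fix x hx := by
    rw [coe_mem_conj_iff] at hx
    rw [conjExp_apply, hE.fix _ hx]
    simp only [mul_assoc, unitary_mul_star_cancel, unitary_mul_star, mul_one]
  pos x hx := by
    have h := hE.pos (star (u : M Γ) * x * u)
      (hx.adjoint_conj ((u : M Γ) : L2 Γ →L[ℂ] L2 Γ))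
    exact h.conj_adjoint ((u : M Γ) : L2 Γ →L[ℂ] L2 Γ)
  bimodule a b x ha hb := by
    rw [coe_mem_conj_iff] at ha hb
    have h := hE.bimodule _ _ (star (u : M Γ) * x * u) ha hb
    have h2 : star (u : M Γ) * a * u * (star (u : M Γ) * x * u) * (star (u : M Γ) * b * u) =
        star (u : M Γ) * (a * x * b) * u := by
      simp only [mul_assoc, unitary_mul_star_cancel]
    rw [h2] at h
    rw [conjExp_apply, conjExp_apply, h]
    simp only [mul_assoc, unitary_mul_star_cancel, unitary_mul_star, mul_one]
  tr_eq x := by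
    rw [conjExp_apply, tr_conj, hE.tr_eq, tr_star_conj]

end Conj

end GroupVN

/-! ### Malnormality of free factors generated by a subset of the generators -/

namespace FreeGroup

universe u

variable {α : Type u}

/-- Induction on the length of the reduced word of `c`. A leading letter `a^{±1}` is stripped off.
Any other leading letter prevents cancellation in `a^j c`, hence by length also in `c a^j`, and the
two reduced words begin differently. -/
theorem mem_zpowers_of_commute_of_pow (a : α) {j : ℕ} (hj : 0 < j) (c : FreeGroup α)
    (hc : of a ^ j * c = c * of a ^ j) : c ∈ Subgroup.zpowers (of a) := by
  classical
  induction hn : c.toWord.length using Nat.strong_induction_on generalizing c with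
  | _ n ih =>
  rcases hw : c.toWord with _ | ⟨⟨b, ε⟩, L⟩
  · rw [toWord_eq_nil_iff.1 hw]
    exact one_mem _
  have hcL : c = mk [(b, ε)] * mk L := by
    rw [mul_mk, ← mk_toWord (x := c), hw]
    rfl
  by_cases hb : b = a
  · subst hb
    have hg : (mk [(b, ε)] : FreeGroup α) ∈ Subgroup.zpowers (of b) := by
      cases ε
      · exact Subgroup.mem_zpowers_iff.2 ⟨-1, by simp [of, inv_mk, invRev]⟩
      · exact Subgroup.mem_zpowers (of b)
    have hcomm : of b ^ j * mk [(b, ε)] = mk [(b, ε)] * of b ^ j := by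
      obtain ⟨i, hi⟩ := Subgroup.mem_zpowers_iff.1 hg
      rw [← hi]
      exact (((Commute.refl (of b)).pow_left j).zpow_right i).eq
    have hlt : (mk L).toWord.length < n := by
      rw [← hn, hw, toWord_mk, List.length_cons]
      exact Nat.lt_succ_of_le (Red.length_le reduce.red)
    rw [hcL]
    refine mul_mem hg (ih _ hlt (mk L) ?_ rfl)
    rw [hcL, ← mul_assoc, hcomm, mul_assoc, mul_assoc] at hc
    exact mul_left_cancel hc
  · exfalso
    have h1 : (of a ^ j * c).toWord = List.replicate j (a, true) ++ c.toWord := by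
      rw [toWord_mul, toWord_of_pow]
      refine IsReduced.reduce_eq ?_
      rw [IsReduced, List.isChain_append]
      refine ⟨?_, isReduced_toWord, ?_⟩
      · exact List.isChain_replicate_of_rel _ (fun _ => rfl)
      · intro x hx y hy h
        rw [hw] at hy
        simp only [List.head?_cons, Option.mem_def, Option.some.injEq] at hy
        have hx' := List.eq_of_mem_replicate (List.mem_of_getLast? hx)
        subst hx' hy
        exact absurd h.symm hb
    -- The reduced word of the product is a sublist of the concatenation, and `h1` shows that it has
    -- full length.
    have h2 : (c * of a ^ j).toWord = c.toWord ++ List.replicate j (a, true) := by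
      have hs := toWord_mul_sublist c (of a ^ j)
      rw [toWord_of_pow] at hs
      refine hs.eq_of_length ?_
      rw [← hc, h1]
      simp [add_comm]
    rw [hc, h2, hw] at h1
    obtain ⟨i, rfl⟩ := Nat.exists_eq_add_of_lt hj
    rw [zero_add, List.replicate_succ] at h1
    simp only [List.cons_append, List.cons.injEq, Prod.mk.injEq] at h1
    exact hb h1.1.1

/-- The retraction `r` that kills the generators outside `A` fixes `h⁻¹ a^j h` and `a^j`. Comparing
the two forms, `h r(h)⁻¹` commutes with `a^j`, so it is a power of `a`, and `h` lies in the image of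
`r` times that power. -/
theorem mem_closure_of_conj_pow_mem (A : Set α) {a : α} (ha : a ∈ A) {j : ℕ} (hj : 0 < j)
    (h : FreeGroup α) (hh : h⁻¹ * of a ^ j * h ∈ Subgroup.closure (of '' A)) :
    h ∈ Subgroup.closure (of '' A) := by
  classical
  let r : FreeGroup α →* FreeGroup α := lift fun i => if i ∈ A then of i else 1
  have hfix : ∀ g ∈ Subgroup.closure (of '' A), r g = g := by
    intro g hg
    have : Subgroup.closure (of '' A) ≤ MonoidHom.eqLocus r (MonoidHom.id _) := by
      rw [Subgroup.closure_le]
      rintro _ ⟨i, hi, rfl⟩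
      change r (of i) = of i
      simp [r, hi]
    exact this hg
  have hr : ∀ g, r g ∈ Subgroup.closure (of '' A) := by
    intro g
    have : r.range ≤ Subgroup.closure (of '' A) := by
      rw [range_lift_eq_closure, Subgroup.closure_le]
      rintro _ ⟨i, rfl⟩
      by_cases hi : i ∈ A
      · simpa [hi] using Subgroup.subset_closure (Set.mem_image_of_mem of hi)
      · simp [hi]
    exact this ⟨g, rfl⟩
  have haj : of a ^ j ∈ Subgroup.closure (of '' A) :=
    pow_mem (Subgroup.subset_closure (Set.mem_image_of_mem of ha)) j
  have h1 := hfix _ hh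
  rw [_root_.map_mul, _root_.map_mul, _root_.map_inv, hfix _ haj] at h1
  have h2 : h * (r h)⁻¹ ∈ Subgroup.zpowers (of a) := by
    refine mem_zpowers_of_commute_of_pow a hj _ ?_
    calc of a ^ j * (h * (r h)⁻¹) = h * (h⁻¹ * of a ^ j * h) * (r h)⁻¹ := by group
      _ = h * (r h)⁻¹ * of a ^ j := by rw [← h1]; group
  have h3 : h * (r h)⁻¹ ∈ Subgroup.closure (of '' A) :=
    (Subgroup.zpowers_le.2 (Subgroup.subset_closure (Set.mem_image_of_mem of ha))) h2
  simpa using mul_mem h3 (hr h)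

end FreeGroup

namespace GroupVN

universe u

open Filter Topology

/-! ### Asymptotic orthogonality -/

section Mixing

variable {Γ : Type u} [Group Γ]

/-- The vector `T δ_{s k}` is a right translate of `f = T δ_e`. At the point `x * s k` its value is
`f x`, each `x` is eventually cut off by the restriction, and `‖f x‖²` dominates. -/
theorem tendsto_restrict_apply_delta (G : Subgroup Γ) {T : L2 Γ →L[ℂ] L2 Γ}
    (hT : ∀ g, T * rightRegular g = rightRegular g * T) {s : ℕ → Γ}
    (hs : ∀ x, ∀ᶠ k in atTop, x * s k ∉ G) :
    Tendsto (fun k => restrict (G : Set Γ) (T (delta (s k)))) atTop (𝓝 0) := by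
  set f := T (delta 1)
  have h1 : ∀ k, HasSum (fun x => ‖restrict (G : Set Γ) (T (delta (s k))) (x * s k)‖ ^ 2)
      (‖restrict (G : Set Γ) (T (delta (s k)))‖ ^ 2) := fun k =>
    hasSum_mul_right (F := fun t => ‖restrict (G : Set Γ) (T (delta (s k))) t‖ ^ 2)
      (hasSum_norm_sq _) (s k)
  have hb : ∀ k x, ‖restrict (G : Set Γ) (T (delta (s k))) (x * s k)‖ ≤ ‖f x‖ := fun k x => by
    have h := norm_indicator_le_norm_self (s := (G : Set Γ)) (T (delta (s k)) : Γ → ℂ) (x * s k)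
    rwa [apply_delta_of_commute hT, mul_inv_cancel_right] at h
  have h2 : Tendsto (fun k => ∑' x, ‖restrict (G : Set Γ) (T (delta (s k))) (x * s k)‖ ^ 2) atTop
      (𝓝 (∑' _ : Γ, (0 : ℝ))) := by
    refine tendsto_tsum_of_dominated_convergence (hasSum_norm_sq f).summable (fun x => ?_)
      (Eventually.of_forall fun k x => ?_)
    · refine tendsto_const_nhds.congr' ?_
      filter_upwards [hs x] with k hk
      rw [restrict_apply_notMem _ (by exact hk)]
      simp
    · rw [norm_pow, norm_norm]
      exact pow_le_pow_left₀ (norm_nonneg _) (hb k x) 2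
  simp only [(h1 _).tsum_eq, tsum_zero] at h2
  rw [tendsto_zero_iff_norm_tendsto_zero]
  have h3 := h2.sqrt
  simpa only [Real.sqrt_sq (norm_nonneg _), Real.sqrt_zero] using h3

/-- The operators `A k` are bounded by `‖T‖` uniformly in `k`, so convergence on the `δ_h` suffices;
those with `h ∈ G` are killed by the truncation. -/
theorem tendsto_restrict_apply_leftRegular (G : Subgroup Γ) {T : L2 Γ →L[ℂ] L2 Γ}
    (hT : ∀ g, T * rightRegular g = rightRegular g * T) {w : ℕ → Γ}
    (hw : ∀ h ∉ G, ∀ x, ∀ᶠ k in atTop, x * (w k * h) ∉ G) (f : L2 Γ) :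
    Tendsto (fun k => restrict (G : Set Γ) (T (leftRegular (w k) (restrict (G : Set Γ)ᶜ f))))
      atTop (𝓝 0) := by
  set A : ℕ → L2 Γ →L[ℂ] L2 Γ := fun k =>
    restrict (G : Set Γ) * T * leftRegular (w k) * restrict (G : Set Γ)ᶜ
  change Tendsto (fun k => A k f) atTop (𝓝 0)
  have hA : ∀ k q, ‖A k q‖ ≤ ‖T‖ * ‖q‖ := fun k q => by
    refine (norm_restrict_le _ _).trans ((T.le_opNorm _).trans ?_)
    refine mul_le_mul_of_nonneg_left ?_ (norm_nonneg _)
    exact (norm_leftRegular_apply _ _).trans_le (norm_restrict_le _ _)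
  have hδ : ∀ h, Tendsto (fun k => A k (delta h)) atTop (𝓝 0) := fun h => by
    by_cases hh : h ∈ G
    · have h0 : restrict (G : Set Γ)ᶜ (delta h) = 0 := by
        ext k
        by_cases hk : k ∈ G
        · rw [restrict_apply_notMem _ (by simpa using hk)]
          rfl
        · rw [restrict_apply_mem _ (by exact hk), delta_apply_of_ne]
          · rfl
          · rintro rfl
            exact hk hh
      simp only [A, mul_apply_eq_comp, h0, map_zero]
      exact tendsto_const_nhds
    · have h0 : restrict (G : Set Γ)ᶜ (delta h) = delta h := restrict_delta_mem hh
      simp only [A, mul_apply_eq_comp, h0, leftRegular_delta]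
      exact tendsto_restrict_apply_delta G hT (hw h hh)
  rw [Metric.tendsto_atTop]
  intro ε hε
  -- The added `1` keeps the divisor positive when `T = 0`.
  have hC : 0 < ‖T‖ + 1 := by positivity
  obtain ⟨s, hs⟩ := ((hasSum_delta f).eventually
    (Metric.ball_mem_nhds f (show 0 < ε / 2 / (‖T‖ + 1) by positivity))).exists
  set q := ∑ i ∈ s, f i • delta i
  have hq : Tendsto (fun k => A k q) atTop (𝓝 0) := by
    have h := tendsto_finsetSum s fun i _ => (hδ i).const_smul (f i)
    simpa only [q, map_sum, map_smul, smul_zero, Finset.sum_const_zero] using h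
  obtain ⟨K, hK⟩ := Metric.tendsto_atTop.1 hq (ε / 2) (half_pos hε)
  refine ⟨K, fun k hk => ?_⟩
  have h1 := hK k hk
  rw [dist_zero_right] at h1 ⊢
  have h2 : ‖A k (f - q)‖ < ε / 2 := by
    refine (hA k _).trans_lt ?_
    rw [dist_comm, dist_eq_norm, lt_div_iff₀ hC] at hs
    nlinarith [norm_nonneg (f - q)]
  have h3 : A k f = A k (f - q) + A k q := by rw [← map_add, sub_add_cancel]
  rw [h3]
  linarith [norm_add_le (A k (f - q)) (A k q)]

theorem norm_unitary_apply (u : unitary (M Γ)) (f : L2 Γ) :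
    ‖((u : M Γ) : L2 Γ →L[ℂ] L2 Γ) f‖ = ‖f‖ :=
  ContinuousLinearMap.norm_map_of_mem_unitary (unitary_coe_mem u) f

/-- The left translation by `g`, as an element of `VN(Γ)`. -/
noncomputable def leftTranslation (g : Γ) : M Γ :=
  ⟨leftRegular g, leftRegular_mem_VN (Subgroup.mem_top g)⟩

/-- The vector of `u` is split along `G` and its complement; on the part in `G`, `u*` and `λ(g)` are
isometric and truncation is contractive. -/
theorem norm_vec_subgroupExp_conj_leftTranslation_le (G : Subgroup Γ) (u : unitary (M Γ))
    (g : Γ) :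
    ‖vec (subgroupExp G (star (u : M Γ) * leftTranslation g * (u : M Γ)))‖ ≤
      ‖restrict (G : Set Γ) (vec (u : M Γ))‖ +
        ‖restrict (G : Set Γ) (((star (u : M Γ) : M Γ) : L2 Γ →L[ℂ] L2 Γ)
          (leftRegular g (restrict (G : Set Γ)ᶜ (vec (u : M Γ)))))‖ := by
  have h : vec (star (u : M Γ) * leftTranslation g * (u : M Γ)) =
      ((star (u : M Γ) : M Γ) : L2 Γ →L[ℂ] L2 Γ) (leftRegular g (vec (u : M Γ))) := rfl
  rw [vec_subgroupExp, h]
  conv_lhs => rw [← restrict_add_restrict_compl (G : Set Γ) (vec (u : M Γ))]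
  rw [map_add, map_add, map_add]
  refine (norm_add_le _ _).trans (add_le_add_left ?_ _)
  refine (norm_restrict_le _ _).trans ?_
  have h1 := norm_unitary_apply (star u)
    (leftRegular g (restrict (G : Set Γ) (vec (u : M Γ))))
  rw [norm_leftRegular_apply] at h1
  exact h1.le

/-- The difference of expectations is tested on `λ(g)`, which is fixed by the expectation onto `VN
G`; Pythagoras for the conjugated expectation evaluates the result. -/
theorem one_sub_norm_sq_le_normInfTwo_sq (G : Subgroup Γ) (u : unitary (M Γ)) {g : Γ}
    (hg : g ∈ G) :
    1 - ‖vec (subgroupExp G (star (u : M Γ) * leftTranslation g * (u : M Γ)))‖ ^ 2 ≤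
      normInfTwo (conjExp u (subgroupExp G) - subgroupExp G) ^ 2 := by
  have hE := isCondExp_subgroupExp G
  have hE' := hE.conjExp u
  have hv1 : ‖vec (leftTranslation g)‖ = 1 := (norm_leftRegular_apply _ _).trans (norm_delta 1)
  have hv : ‖(leftTranslation g : L2 Γ →L[ℂ] L2 Γ)‖ ≤ 1 :=
    ContinuousLinearMap.opNorm_le_bound _ zero_le_one fun f => by
      rw [one_mul]
      exact (norm_leftRegular_apply g f).le
  have h1 : normTwo ((conjExp u (subgroupExp G) - subgroupExp G) (leftTranslation g)) ≤
      normInfTwo (conjExp u (subgroupExp G) - subgroupExp G) :=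
    le_csSup (bddAbove_unitBallValues_sub hE hE') ⟨leftTranslation g, hv, rfl⟩
  rw [LinearMap.sub_apply, hE.fix (leftTranslation g) (leftRegular_mem_VN hg), normTwo_eq] at h1
  have h2 := pow_le_pow_left₀ (norm_nonneg _) h1 2
  rwa [hE'.norm_sq_vec_sub, hv1, one_pow, conjExp_apply, norm_vec_conj] at h2

theorem normInfTwo_nonneg (φ : M Γ →ₗ[ℂ] M Γ) : 0 ≤ normInfTwo φ :=
  Real.sSup_nonneg fun _ ⟨_, _, hr⟩ => hr ▸ Real.sqrt_nonneg _

/-- The perturbation estimate for `VN(G) ⊆ VN(Γ)`, when `G` contains a sequence that leaves all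
sets `x G h` with `h ∉ G`. -/
theorem normTwo_sub_condExp_le (G : Subgroup Γ) {w : ℕ → Γ} (hwG : ∀ k, w k ∈ G)
    (hw : ∀ h ∉ G, ∀ x, ∀ᶠ k in atTop, x * (w k * h) ∉ G) (u : unitary (M Γ)) :
    normTwo ((u : M Γ) - condExp (VN G) u) ≤
      normInfTwo (condExp (conj u (VN G)) - condExp (VN G)) := by
  have hE := isCondExp_subgroupExp G
  rw [hE.condExp_eq, (hE.conjExp u).condExp_eq]
  have hab : ‖restrict (G : Set Γ) (vec (u : M Γ))‖ ^ 2 +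
      ‖restrict (G : Set Γ)ᶜ (vec (u : M Γ))‖ ^ 2 = 1 := by
    rw [← norm_sq_eq_restrict_add, vec, norm_unitary_apply, norm_delta, one_pow]
  have hlhs : normTwo ((u : M Γ) - subgroupExp G u) =
      ‖restrict (G : Set Γ)ᶜ (vec (u : M Γ))‖ := by
    rw [normTwo_eq, vec_sub, vec_subgroupExp]
    congr 1
    exact sub_eq_of_eq_add' (restrict_add_restrict_compl _ _).symm
  have hr := tendsto_zero_iff_norm_tendsto_zero.1 (tendsto_restrict_apply_leftRegular G
    (M_commute (star (u : M Γ))) hw (vec (u : M Γ)))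
  have hlim := (tendsto_const_nhds (x := (1 : ℝ))).sub
    (((tendsto_const_nhds (x := ‖restrict (G : Set Γ) (vec (u : M Γ))‖)).add hr).pow 2)
  -- The right side does not depend on `k`, so the bound survives the limit, leaving `1 -
  -- ‖E_N(u)‖₂²` on the left.
  have hfin := le_of_tendsto' hlim fun k =>
    (sub_le_sub_left (pow_le_pow_left₀ (norm_nonneg _)
      (norm_vec_subgroupExp_conj_leftTranslation_le G u (w k)) 2) 1).trans
      (one_sub_norm_sq_le_normInfTwo_sq G u (hwG k))
  rw [hlhs]
  refine (pow_le_pow_iff_left₀ (norm_nonneg _) (normInfTwo_nonneg _) two_ne_zero).1 ?_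
  rw [add_zero] at hfin
  linarith

end Mixing

/-! ### Free groups -/

/-- If the exponents `j < k` both gave elements of the subgroup, their quotient `h⁻¹ g_i^{k-j} h`
would lie in it, forcing `h` into it. -/
theorem eventually_mul_pow_mul_notMem_firstGenerators {n m : ℕ∞}
    (i : {i : ℕ // (i : ℕ∞) < m}) (hi : ((i : ℕ) : ℕ∞) < n) (h : Free m)
    (hh : h ∉ firstGenerators n m) (x : Free m) :
    ∀ᶠ k in atTop, x * (FreeGroup.of i ^ k * h) ∉ firstGenerators n m := by
  by_cases hex : ∃ j, x * (FreeGroup.of i ^ j * h) ∈ firstGenerators n m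
  · obtain ⟨j, hj⟩ := hex
    filter_upwards [eventually_gt_atTop j] with k hk hmem
    refine hh (FreeGroup.mem_closure_of_conj_pow_mem _ (a := i) hi (Nat.sub_pos_of_lt hk) h ?_)
    have h1 := mul_mem (inv_mem hj) hmem
    rw [← Nat.add_sub_cancel' hk.le, pow_add] at h1
    have h2 : h⁻¹ * FreeGroup.of i ^ (k - j) * h = (x * (FreeGroup.of i ^ j * h))⁻¹ *
        (x * (FreeGroup.of i ^ j * FreeGroup.of i ^ (k - j) * h)) := by
      simp only [mul_inv_rev, mul_assoc, inv_mul_cancel_left]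
    rw [h2]
    exact h1
  · push Not at hex
    exact Eventually.of_forall hex

end GroupVN

theorem corollary3p7 (n m : ℕ∞) (hn : 1 ≤ n) (hnm : n < m)
    (N : VonNeumannAlgebra (GroupVN.L2 (GroupVN.Free m)))
    (hN : N = GroupVN.VN (GroupVN.firstGenerators n m)) :
    (∃! E : GroupVN.M (GroupVN.Free m) →ₗ[ℂ] GroupVN.M (GroupVN.Free m),
      GroupVN.IsCondExp N E) ∧
    ∀ u : unitary (GroupVN.M (GroupVN.Free m)),
      (∃! E : GroupVN.M (GroupVN.Free m) →ₗ[ℂ] GroupVN.M (GroupVN.Free m),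
        GroupVN.IsCondExp (GroupVN.conj u N) E) ∧
      BddAbove (GroupVN.unitBallValues
        (GroupVN.condExp (GroupVN.conj u N) - GroupVN.condExp N)) ∧
      GroupVN.normTwo ((u : GroupVN.M (GroupVN.Free m)) - GroupVN.condExp N u) ≤
        GroupVN.normInfTwo (GroupVN.condExp (GroupVN.conj u N) - GroupVN.condExp N) := by
  subst hN
  have hE := GroupVN.isCondExp_subgroupExp (GroupVN.firstGenerators n m)
  refine ⟨⟨_, hE, fun E h => h.unique hE⟩, fun u => ?_⟩
  have hE' := hE.conjExp u
  refine ⟨⟨_, hE', fun E h => h.unique hE'⟩, ?_, ?_⟩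
  · rw [hE.condExp_eq, hE'.condExp_eq]
    exact GroupVN.bddAbove_unitBallValues_sub hE hE'
  · have h0n : ((0 : ℕ) : ℕ∞) < n := lt_of_lt_of_le (by simp) hn
    -- Generators are numbered from `0`, so `1 ≤ n` puts this one in the subgroup.
    let i : {i : ℕ // (i : ℕ∞) < m} := ⟨0, h0n.trans hnm⟩
    refine GroupVN.normTwo_sub_condExp_le _ (w := fun k => FreeGroup.of i ^ k) (fun k => ?_)
      (GroupVN.eventually_mul_pow_mul_notMem_firstGenerators i h0n) u
    have hi : FreeGroup.of i ∈ GroupVN.firstGenerators n m :=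
      Subgroup.subset_closure ⟨i, h0n, rfl⟩
    exact pow_mem hi k
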